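/- Let $n\ge 1$, let $k$ be a commutative artinian ring, and let $(\mathcal C,\mathbb E,\mathfrak s)$ be a $k$-linear $n$-exangulated category (in the sense of Herschend–Liu–Nakaoka) that is Krull–Schmidt and Ext-finite, i.e. every $\mathbb E(B,A)$ is a finitely generated $k$-module. Assume moreover that, for composable morphisms $f$ and $g$, if $g\circ f$ is a deflation then so is $g$, and if $g\circ f$ is an inflation then so is $f$. We use the following notions. A morphism $g\colon Z\to Y$ *almost factors through* $f\colon X\to Y$ if $g$ does not factor through $f$, but $g\circ h$ factors through $f$ for every object $T$ and every $h\in\operatorname{rad}_{\mathcal C}(T,Z)$. Two morphisms with the same target are *right equivalent* if each factors through the other. An object $K$ is an *intrinsic weak $n$-kernel* of a deflation $f\colon X\to Y$ if there is a distinguished $n$-exangle $K\to Z_1\to\cdots\to Z_n\xrightarrow{f'}Y\dashrightarrow$ in which $f'$ is right minimal and right equivalent to $f$. An *Auslander–Reiten $n$-exangle* is a distinguished $n$-exangle $Z_0\xrightarrow{\gamma_0}Z_1\to\cdots\to Z_n\xrightarrow{\gamma_n}Z_{n+1}\overset{\rho}{\dashrightarrow}$ such that $\gamma_0$ is left almost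 split, $\gamma_n$ is right almost split and $\gamma_1,\dots,\gamma_{n-1}\in\operatorname{rad}_{\mathcal C}$. **Lemma.** Let $a_n\colon X_n\to X_{n+1}$ be a deflation and let $C$ be an indecomposable object of $\mathcal C$. If there exists a morphism $h_{n+1}\colon C\to X_{n+1}$ which almost factors through $a_n$, then there exists an Auslander–Reiten $n$-exangle $$Z_0\xrightarrow{\gamma_0}Z_1\xrightarrow{\gamma_1}\cdots\xrightarrow{\gamma_{n-1}}Z_n\xrightarrow{\gamma_n}C\overset{\rho}{\dashrightarrow}$$ such that $Z_0$ is a direct summand of every intrinsic weak $n$-kernel of $a_n$; and $a_n$ has at least one intrinsic weak $n$-kernel. -/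

import Mathlib

open CategoryTheory CategoryTheory.Limits Opposite

universe t u v w

namespace NExangulated

section Additive

variable {C : Type u} [Category.{v} C] [Preadditive C]

/-! ### Notions for morphisms of a preadditive category -/

/-- The Jacobson radical of the category: `f` is radical if `1 - g ∘ f` is invertible for every
`g` in the opposite direction. -/
def IsRadical {X Y : C} (f : X ⟶ Y) : Prop :=
  ∀ g : Y ⟶ X, IsIso (𝟙 X - f ≫ g)

/-- `g : Z ⟶ Y` factors through `f : X ⟶ Y`. -/
def FactorsThrough {X Y Z : C} (g : Z ⟶ Y) (f : X ⟶ Y) : Prop :=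
  ∃ h : Z ⟶ X, h ≫ f = g

/-- `g` almost factors through `f`: it does not factor through `f`, but every composite of `g` with
a radical morphism does. -/
def AlmostFactorsThrough {X Y Z : C} (g : Z ⟶ Y) (f : X ⟶ Y) : Prop :=
  ¬ FactorsThrough g f ∧
    ∀ (T : C) (h : T ⟶ Z), IsRadical h → FactorsThrough (h ≫ g) f

def IsRightMinimal {X Y : C} (f : X ⟶ Y) : Prop :=
  ∀ e : X ⟶ X, e ≫ f = f → IsIso e

def IsRightEquivalent {X X' Y : C} (f : X ⟶ Y) (f' : X' ⟶ Y) : Prop :=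
  FactorsThrough f f' ∧ FactorsThrough f' f

/-- `f'` is a right minimal version of `f`. -/
def IsRightMinimalVersion {X X' Y : C} (f' : X' ⟶ Y) (f : X ⟶ Y) : Prop :=
  IsRightMinimal f' ∧ IsRightEquivalent f f'

def IsRightAlmostSplit {X Y : C} (f : X ⟶ Y) : Prop :=
  ¬ IsSplitEpi f ∧ ∀ (W : C) (g : W ⟶ Y), ¬ IsSplitEpi g → ∃ h : W ⟶ X, h ≫ f = g

def IsLeftAlmostSplit {X Y : C} (f : X ⟶ Y) : Prop :=
  ¬ IsSplitMono f ∧ ∀ (W : C) (g : X ⟶ W), ¬ IsSplitMono g → ∃ h : Y ⟶ W, f ≫ h = g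

def IsDirectSummand [HasBinaryBiproducts C] (X Y : C) : Prop :=
  ∃ W : C, Nonempty (Y ≅ X ⊞ W)

variable (C) in
/-- Every object is a finite direct sum of objects with local endomorphism rings. -/
def IsKrullSchmidt [HasFiniteBiproducts C] : Prop :=
  ∀ X : C, ∃ (m : ℕ) (F : Fin m → C),
    (∀ i, IsLocalRing (End (F i))) ∧ Nonempty (X ≅ ⨁ F)

/-! ### Complexes of length `n + 2` with prescribed end terms -/

/-- A complex `X₀ ⟶ X₁ ⟶ ⋯ ⟶ Xₙ₊₁`, i.e. a cochain complex that vanishes in degrees `> n + 1`,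
together with identifications `X₀ ≅ A` and `Xₙ₊₁ ≅ B` of its end terms. -/
structure NComplex (n : ℕ) (A B : C) where
  K : CochainComplex C ℕ
  isZero : ∀ i, n + 1 < i → IsZero (K.X i)
  left : K.X 0 ≅ A
  right : K.X (n + 1) ≅ B

namespace NComplex

variable {n : ℕ} {A B A' B' : C}

/-- The first differential, as a morphism `A ⟶ X₁`. -/
def first (X : NComplex n A B) : A ⟶ X.K.X 1 := X.left.inv ≫ X.K.d 0 1

/-- The last differential, as a morphism `Xₙ ⟶ B`. -/
def last (X : NComplex n A B) : X.K.X n ⟶ B := X.K.d n (n + 1) ≫ X.right.hom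

/-- The chain map `f` has the form `(a, f₁, …, fₙ, c)`. -/
def HasEnds (X : NComplex n A B) (Y : NComplex n A' B') (f : X.K ⟶ Y.K)
    (a : A ⟶ A') (c : B ⟶ B') : Prop :=
  f.f 0 ≫ Y.left.hom = X.left.hom ≫ a ∧ f.f (n + 1) ≫ Y.right.hom = X.right.hom ≫ c

/-- Homotopy equivalence relative to the end terms: the two chain maps are of the form
`(1, f₁, …, fₙ, 1)` and mutually inverse up to homotopy. -/
def HomotopyEquivalent (X Y : NComplex n A B) : Prop :=
  ∃ e : HomotopyEquiv X.K Y.K,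
    HasEnds X Y e.hom (𝟙 A) (𝟙 B) ∧ HasEnds Y X e.inv (𝟙 A) (𝟙 B)

theorem homotopyEquivalent_equivalence :
    Equivalence (HomotopyEquivalent (C := C) (n := n) (A := A) (B := B)) where
  refl X := ⟨HomotopyEquiv.refl _, by simp [HasEnds], by simp [HasEnds]⟩
  symm := by
    rintro X Y ⟨e, h₁, h₂⟩
    exact ⟨e.symm, h₂, h₁⟩
  trans := by
    rintro X Y Z ⟨e, h₁, h₂⟩ ⟨e', h₁', h₂'⟩
    simp only [HasEnds, Category.comp_id] at *
    refine ⟨e.trans e', ⟨?_, ?_⟩, ⟨?_, ?_⟩⟩ <;> simp [*]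

instance setoid (n : ℕ) (A B : C) : Setoid (NComplex n A B) :=
  ⟨HomotopyEquivalent, homotopyEquivalent_equivalence⟩

end NComplex

/-- Homotopy equivalence classes of complexes of length `n + 2` with end terms `A` and `B`. -/
def HomotopyClass (n : ℕ) (A B : C) : Type (max u v) :=
  Quotient (NComplex.setoid n A B)

/-- For a chain map `f : X ⟶ Y` with `f₀ = 1`, the data exhibiting `M` as its mapping cone
`X₁ ⟶ X₂ ⊞ Y₁ ⟶ ⋯ ⟶ Xₙ₊₁ ⊞ Yₙ ⟶ Yₙ₊₁`: identifications of the inner terms with biproducts under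
which the differentials are the matrices of the mapping cone. -/
structure MappingCone [HasBinaryBiproducts C] {n : ℕ} {A B D : C}
    (X : NComplex n A B) (Y : NComplex n A D)
    (f : X.K ⟶ Y.K) (M : NComplex n (X.K.X 1) D) where
  iso : ∀ i, 1 ≤ i → i ≤ n → (M.K.X i ≅ X.K.X (i + 1) ⊞ Y.K.X i)
  first_eq : ∀ h : 1 ≤ n,
    M.first ≫ (iso 1 le_rfl h).hom = biprod.lift (-X.K.d 1 2) (f.f 1)
  d_eq : ∀ (i : ℕ) (h₁ : 1 ≤ i) (h₂ : i + 1 ≤ n),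
    (iso i h₁ (Nat.le_of_succ_le h₂)).inv ≫ M.K.d i (i + 1) ≫
        (iso (i + 1) (Nat.le_add_left 1 i) h₂).hom =
      biprod.desc
        (biprod.lift (-X.K.d (i + 1) (i + 2)) (f.f (i + 1)))
        (biprod.lift 0 (Y.K.d i (i + 1)))
  last_eq : ∀ h : 1 ≤ n,
    (iso n h le_rfl).inv ≫ M.last = biprod.desc (f.f (n + 1) ≫ Y.right.hom) Y.last

/-- For a chain map `f : X ⟶ Y` with `fₙ₊₁ = 1`, the data exhibiting `N` as its mapping cocone
`X₀ ⟶ Y₀ ⊞ X₁ ⟶ Y₁ ⊞ X₂ ⟶ ⋯ ⟶ Yₙ₋₁ ⊞ Xₙ ⟶ Yₙ`. The term in degree `i + 1` is `Yᵢ ⊞ Xᵢ₊₁`. -/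
structure MappingCocone [HasBinaryBiproducts C] {n : ℕ} {A A' B : C}
    (X : NComplex n A B) (Y : NComplex n A' B)
    (f : X.K ⟶ Y.K) (N : NComplex n A (Y.K.X n)) where
  iso : ∀ i j, i + 1 = j → j ≤ n → (N.K.X j ≅ Y.K.X i ⊞ X.K.X j)
  first_eq : ∀ h : 1 ≤ n,
    N.first ≫ (iso 0 1 rfl h).hom = biprod.lift (X.left.inv ≫ f.f 0) X.first
  d_eq : ∀ (i j l : ℕ) (hij : i + 1 = j) (hjl : j + 1 = l) (hl : l ≤ n),
    (iso i j hij (by omega)).inv ≫ N.K.d j l ≫ (iso j l hjl hl).hom =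
      biprod.desc
        (biprod.lift (-Y.K.d i j) 0)
        (biprod.lift (f.f j) (X.K.d j l))
  last_eq : ∀ (i : ℕ) (h : i + 1 = n),
    (iso i n h le_rfl).inv ≫ N.last = biprod.desc (-Y.K.d i n) (f.f n)

end Additive

/-! ### Extensions -/

section Extensions

variable {k : Type t} [CommRing k] {C : Type u} [Category.{v} C] [Preadditive C]

/-- The module `𝔼(B, A)` of extensions; `𝔼` is contravariant in `B` and covariant in `A`. -/
abbrev Extension (E : Cᵒᵖ ⥤ C ⥤ ModuleCat.{w} k) (B A : C) : Type w :=
  (E.obj (op B)).obj A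

/-- `a_* δ` -/
def push (E : Cᵒᵖ ⥤ C ⥤ ModuleCat.{w} k) {B A A' : C} (a : A ⟶ A') (δ : Extension E B A) :
    Extension E B A' :=
  ((E.obj (op B)).map a).hom δ

/-- `c^* δ` -/
def pull (E : Cᵒᵖ ⥤ C ⥤ ModuleCat.{w} k) {B B' A : C} (c : B' ⟶ B) (δ : Extension E B A) :
    Extension E B' A :=
  ((E.map c.op).app A).hom δ

/-- `𝔼` is a `k`-bilinear bifunctor. -/
structure IsBilinear [Linear k C] (E : Cᵒᵖ ⥤ C ⥤ ModuleCat.{w} k) : Prop where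
  push_add : ∀ {A A' B : C} (a a' : A ⟶ A') (δ : Extension E B A),
    push E (a + a') δ = push E a δ + push E a' δ
  push_smul : ∀ {A A' B : C} (r : k) (a : A ⟶ A') (δ : Extension E B A),
    push E (r • a) δ = r • push E a δ
  pull_add : ∀ {A B B' : C} (c c' : B' ⟶ B) (δ : Extension E B A),
    pull E (c + c') δ = pull E c δ + pull E c' δ
  pull_smul : ∀ {A B B' : C} (r : k) (c : B' ⟶ B) (δ : Extension E B A),
    pull E (r • c) δ = r • pull E c δ

/-- Every module of extensions is finitely generated. -/
def IsExtFinite (E : Cᵒᵖ ⥤ C ⥤ ModuleCat.{w} k) : Prop :=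
  ∀ A B : C, Module.Finite k (Extension E B A)

variable {E : Cᵒᵖ ⥤ C ⥤ ModuleCat.{w} k} {n : ℕ}

/-- The pair `⟨X, δ⟩` is an `n`-exangle: it is an `𝔼`-attached complex, and the two sequences
`C(T, X₀) → ⋯ → C(T, Xₙ₊₁) → 𝔼(T, X₀)` and `C(Xₙ₊₁, T) → ⋯ → C(X₀, T) → 𝔼(Xₙ₊₁, T)` are exact for
every object `T`. -/
structure IsNExangle {A B : C} (X : NComplex n A B) (δ : Extension E B A) : Prop where
  push_first : push E X.first δ = 0
  pull_last : pull E X.last δ = 0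
  exact_to : ∀ (T : C) (i : ℕ), i < n → Function.Exact
    (fun g : T ⟶ X.K.X i => g ≫ X.K.d i (i + 1))
    (fun g : T ⟶ X.K.X (i + 1) => g ≫ X.K.d (i + 1) (i + 2))
  exact_to_ext : ∀ T : C, Function.Exact
    (fun g : T ⟶ X.K.X n => g ≫ X.last) (fun g : T ⟶ B => pull E g δ)
  exact_from : ∀ (T : C) (i : ℕ), i < n → Function.Exact
    (fun g : X.K.X (i + 2) ⟶ T => X.K.d (i + 1) (i + 2) ≫ g)
    (fun g : X.K.X (i + 1) ⟶ T => X.K.d i (i + 1) ≫ g)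
  exact_from_ext : ∀ T : C, Function.Exact
    (fun g : X.K.X 1 ⟶ T => X.first ≫ g) (fun g : A ⟶ T => push E g δ)

variable (E n) in
/-- A correspondence that associates to each extension `δ ∈ 𝔼(B, A)` a homotopy equivalence class
of complexes of length `n + 2` with end terms `A` and `B`. -/
abbrev Correspondence : Type (max u v w) :=
  ∀ A B : C, Extension E B A → HomotopyClass n A B

variable (s : Correspondence E n)

/-- `s(δ) = [X]` -/
def Realizes {A B : C} (X : NComplex n A B) (δ : Extension E B A) : Prop :=
  s A B δ = Quotient.mk (NComplex.setoid n A B) X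

/-- `f` is the first differential of a conflation. -/
def IsInflation {A Y : C} (f : A ⟶ Y) : Prop :=
  ∃ (B : C) (δ : Extension E B A) (X : NComplex n A B) (e : X.K.X 1 ≅ Y),
    Realizes s X δ ∧ X.first ≫ e.hom = f

/-- `f` is the last differential of a conflation. -/
def IsDeflation {Y B : C} (f : Y ⟶ B) : Prop :=
  ∃ (A : C) (δ : Extension E B A) (X : NComplex n A B) (e : Y ≅ X.K.X n),
    Realizes s X δ ∧ e.hom ≫ X.last = f

/-- `s` is an exact realization of `𝔼`. -/
structure IsExactRealization : Prop where
  lift : ∀ {A B A' B' : C} (δ : Extension E B A) (ρ : Extension E B' A')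
    (X : NComplex n A B) (Y : NComplex n A' B'), Realizes s X δ → Realizes s Y ρ →
    ∀ (a : A ⟶ A') (c : B ⟶ B'), push E a δ = pull E c ρ →
      ∃ f : X.K ⟶ Y.K, X.HasEnds Y f a c
  isNExangle : ∀ {A B : C} (δ : Extension E B A) (X : NComplex n A B),
    Realizes s X δ → IsNExangle X δ
  /-- `s(0)` is the class of `A = A ⟶ 0 ⟶ ⋯ ⟶ 0` for `0 ∈ 𝔼(0, A)` -/
  zero_right : ∀ A Z : C, IsZero Z → ∃ X : NComplex n A Z,
    Realizes s X (0 : Extension E Z A) ∧ IsIso X.first ∧ ∀ i, 2 ≤ i → IsZero (X.K.X i)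
  /-- `s(0)` is the class of `0 ⟶ ⋯ ⟶ 0 ⟶ A = A` for `0 ∈ 𝔼(A, 0)` -/
  zero_left : ∀ A Z : C, IsZero Z → ∃ X : NComplex n Z A,
    Realizes s X (0 : Extension E A Z) ∧ IsIso X.last ∧ ∀ i, i < n → IsZero (X.K.X i)

/-- For an additive `k`-linear category `C`, `(C, 𝔼, s)` is a `k`-linear `n`-exangulated category (for `k = ℤ`, this is the notion of an
`n`-exangulated category). -/
structure IsNExangulated [Linear k C] [HasBinaryBiproducts C] : Prop where
  pos : 1 ≤ n
  bilinear : IsBilinear E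
  exact : IsExactRealization s
  inflation_comp : ∀ {X Y Z : C} (f : X ⟶ Y) (g : Y ⟶ Z),
    IsInflation s f → IsInflation s g → IsInflation s (f ≫ g)
  deflation_comp : ∀ {X Y Z : C} (f : X ⟶ Y) (g : Y ⟶ Z),
    IsDeflation s f → IsDeflation s g → IsDeflation s (f ≫ g)
  /-- `(1, c)` has a lift whose mapping cone is a distinguished `n`-exangle. -/
  good_lift : ∀ {A B D : C} (c : B ⟶ D) (ρ : Extension E D A)
    (X : NComplex n A B) (Y : NComplex n A D),
    Realizes s X (pull E c ρ) → Realizes s Y ρ →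
    ∃ f : X.K ⟶ Y.K, X.HasEnds Y f (𝟙 A) c ∧
      ∃ M : NComplex n (X.K.X 1) D, Nonempty (MappingCone X Y f M) ∧
        Realizes s M (push E X.first ρ)
  /-- `(a, 1)` has a lift whose mapping cocone is a distinguished `n`-exangle. -/
  good_lift_op : ∀ {A A' B : C} (a : A ⟶ A') (δ : Extension E B A)
    (X : NComplex n A B) (Y : NComplex n A' B),
    Realizes s X δ → Realizes s Y (push E a δ) →
    ∃ f : X.K ⟶ Y.K, X.HasEnds Y f a (𝟙 B) ∧
      ∃ N : NComplex n A (Y.K.X n), Nonempty (MappingCocone X Y f N) ∧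
        Realizes s N (pull E Y.last δ)

/-- If a composite `g ∘ f` is a deflation then so is `g`, and if it is an inflation then so is
`f`. -/
structure WeakIdempotentCondition : Prop where
  deflation : ∀ {X Y Z : C} (f : X ⟶ Y) (g : Y ⟶ Z), IsDeflation s (f ≫ g) → IsDeflation s g
  inflation : ∀ {X Y Z : C} (f : X ⟶ Y) (g : Y ⟶ Z), IsInflation s (f ≫ g) → IsInflation s f

/-- `K` is an intrinsic weak `n`-kernel of the deflation `f`: the first term of a distinguished
`n`-exangle whose last differential is a right minimal version of `f`. -/
def IsIntrinsicWeakKernel {X Y : C} (f : X ⟶ Y) (K : C) : Prop :=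
  IsDeflation s f ∧ ∃ (δ : Extension E Y K) (Z : NComplex n K Y),
    Realizes s Z δ ∧ IsRightMinimalVersion Z.last f

/-- `⟨X, δ⟩` is an Auslander-Reiten `n`-exangle. -/
structure IsAuslanderReiten {A B : C} (X : NComplex n A B) (δ : Extension E B A) : Prop where
  realizes : Realizes s X δ
  left_almost_split : IsLeftAlmostSplit X.first
  right_almost_split : IsRightAlmostSplit X.last
  radical : ∀ i, 1 ≤ i → i + 1 ≤ n → IsRadical (X.K.d i (i + 1))

end Extensions

end NExangulated

/-! Let `δ` be the extension of an `n`-exangle whose last map is a right minimal version of `a`. By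
exactness, a morphism into `Y` factors through `a` exactly when it pulls `δ` back to zero. So "`h`
almost factors through `a`" means that `h^* δ` is nonzero and dies along every radical morphism into
`T`. Pushing it to a suitable indecomposable summand `A` of the weak kernel keeps it nonzero, which
gives an almost vanishing `ρ ∈ 𝔼(T, A)`.

The key fact is `IsAlmostVanishing.exists_push_eq`: every nonzero extension of `T` pushes forward to
`ρ`. It rests on the exactness of `C(A', A) → 𝔼(T, A) → 𝔼(X'ₙ, A)`, obtained from the mapping cocone
axiom. Together with the locality of `End A` it makes the first map of any realization of `ρ` left
almost split; the last map is right almost split because a morphism into `T` that is not a split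
epimorphism is radical. Contracting isomorphic summands of neighbouring inner terms makes the inner
differentials radical.

The key fact also shows that `A` is determined by `T` up to isomorphism, so the same object is a
summand of every intrinsic weak kernel. -/

namespace NExangulated

/-! ### The radical and objects with local endomorphism rings -/

section Radical

variable {C : Type u} [Category.{v} C] [Preadditive C]

theorem isIso_one_sub_comp_swap {X Y : C} (f : X ⟶ Y) (g : Y ⟶ X) (h : IsIso (𝟙 X - f ≫ g)) :
    IsIso (𝟙 Y - g ≫ f) := by
  obtain ⟨r, h₁, h₂⟩ := h
  have h₁' : f ≫ g ≫ r = r - 𝟙 X := by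
    rw [Preadditive.sub_comp, Category.id_comp, Category.assoc] at h₁
    rw [← h₁]; abel
  have h₂' : r ≫ f ≫ g = r - 𝟙 X := by
    rw [Preadditive.comp_sub, Category.comp_id] at h₂
    rw [← h₂]; abel
  -- The formal geometric series: `1 + g(1 + fg + ⋯)f`, with `r` in place of the inner series.
  refine ⟨𝟙 Y + g ≫ r ≫ f, ?_, ?_⟩
  · have h₃ : g ≫ f ≫ g ≫ r ≫ f = g ≫ r ≫ f - g ≫ f := by
      have := congrArg (fun x => g ≫ x ≫ f) h₁'
      simpa using this
    simp [h₃]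
  · have h₃ : g ≫ r ≫ f ≫ g ≫ f = g ≫ r ≫ f - g ≫ f := by
      have := congrArg (fun x => g ≫ x ≫ f) h₂'
      simpa using this
    simp [h₃]

theorem isRadical_iff {X Y : C} (f : X ⟶ Y) :
    IsRadical f ↔ ∀ g : Y ⟶ X, IsIso (𝟙 Y - g ≫ f) :=
  ⟨fun h g => isIso_one_sub_comp_swap _ _ (h g), fun h g => isIso_one_sub_comp_swap _ _ (h g)⟩

theorem IsRadical.comp_right {X Y Z : C} {f : X ⟶ Y} (h : IsRadical f) (g : Y ⟶ Z) :
    IsRadical (f ≫ g) := fun r => by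
  simpa using h (g ≫ r)

theorem IsRadical.comp_left {X Y Z : C} {g : Y ⟶ Z} (h : IsRadical g) (f : X ⟶ Y) :
    IsRadical (f ≫ g) := by
  rw [isRadical_iff] at h ⊢
  intro r
  simpa using h (r ≫ f)

theorem IsRadical.add {X Y : C} {f f' : X ⟶ Y} (h : IsRadical f) (h' : IsRadical f') :
    IsRadical (f + f') := fun g => by
  have := h g
  have := isIso_one_sub_comp_swap (f' ≫ g) (inv (𝟙 X - f ≫ g))
    (by simpa using h' (g ≫ inv (𝟙 X - f ≫ g)))
  have e : 𝟙 X - (f + f') ≫ g =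
      (𝟙 X - f ≫ g) ≫ (𝟙 X - inv (𝟙 X - f ≫ g) ≫ f' ≫ g) := by
    rw [Preadditive.comp_sub, IsIso.hom_inv_id_assoc, Preadditive.add_comp]
    simp only [Category.comp_id]
    abel
  rw [e]
  infer_instance

theorem isRadical_zero (X Y : C) : IsRadical (0 : X ⟶ Y) := fun g => by
  simp only [zero_comp, sub_zero]
  infer_instance

theorem isRadical_sum {ι : Type*} (s : Finset ι) {X Y : C} (f : ι → (X ⟶ Y))
    (h : ∀ i ∈ s, IsRadical (f i)) : IsRadical (∑ i ∈ s, f i) := by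
  classical
  induction s using Finset.induction_on with
  | empty => simpa using isRadical_zero X Y
  | insert a s ha ih =>
    rw [Finset.sum_insert ha]
    exact (h a (Finset.mem_insert_self a s)).add
      (ih fun i hi => h i (Finset.mem_insert_of_mem hi))

/-- The endomorphism ring of `X` is local. -/
def HasLocalEnd (X : C) : Prop :=
  ¬ IsZero X ∧ ∀ f : X ⟶ X, IsIso f ∨ IsIso (𝟙 X - f)

theorem hasLocalEnd_of_isLocalRing {X : C} (h : IsLocalRing (End X)) : HasLocalEnd X := by
  refine ⟨fun hX => ?_, fun f => ?_⟩
  · exact one_ne_zero (α := End X) (hX.eq_of_src _ _)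
  · have := IsLocalRing.isUnit_or_isUnit_of_add_one (R := End X) (a := f) (b := 𝟙 X - f)
      (add_sub_cancel (G := X ⟶ X) f (𝟙 X))
    exact this.imp (isUnit_iff_isIso _).1 (isUnit_iff_isIso _).1

theorem HasLocalEnd.of_iso {X Y : C} (h : HasLocalEnd X) (e : X ≅ Y) : HasLocalEnd Y := by
  refine ⟨fun hY => h.1 (hY.of_iso e), fun f => ?_⟩
  rcases h.2 (e.hom ≫ f ≫ e.inv) with h' | h'
  · left
    have : f = e.inv ≫ (e.hom ≫ f ≫ e.inv) ≫ e.hom := by simp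
    rw [this]; infer_instance
  · right
    have : 𝟙 Y - f = e.inv ≫ (𝟙 X - e.hom ≫ f ≫ e.inv) ≫ e.hom := by simp
    rw [this]; infer_instance

theorem HasLocalEnd.isRadical_of_not_isSplitMono {X Y : C} (h : HasLocalEnd X) (f : X ⟶ Y)
    (hf : ¬ IsSplitMono f) : IsRadical f := fun g => by
  refine (h.2 (f ≫ g)).resolve_left fun hi => hf ?_
  exact IsSplitMono.mk' ⟨g ≫ inv (f ≫ g), by rw [← Category.assoc, IsIso.hom_inv_id]⟩

theorem HasLocalEnd.isRadical_of_not_isSplitEpi {X Y : C} (h : HasLocalEnd Y) (f : X ⟶ Y)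
    (hf : ¬ IsSplitEpi f) : IsRadical f := by
  rw [isRadical_iff]
  intro g
  refine (h.2 (g ≫ f)).resolve_left fun hi => hf ?_
  exact IsSplitEpi.mk' ⟨inv (g ≫ f) ≫ g, by simp⟩

theorem HasLocalEnd.isIso_of_not_isRadical {X Y : C} (hX : HasLocalEnd X) (hY : HasLocalEnd Y)
    (f : X ⟶ Y) (hf : ¬ IsRadical f) : IsIso f := by
  have : IsSplitMono f := not_not.1 fun h => hf (hX.isRadical_of_not_isSplitMono f h)
  have : IsSplitEpi f := not_not.1 fun h => hf (hY.isRadical_of_not_isSplitEpi f h)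
  exact isIso_of_mono_of_isSplitEpi f

end Radical

/-! ### Krull–Schmidt decompositions and right minimal versions -/

section KrullSchmidt

variable {C : Type u} [Category.{v} C] [Preadditive C] [HasFiniteBiproducts C]

/-- `X` is a direct sum of `m` objects with local endomorphism rings. -/
def HasLocalDecomposition (X : C) (m : ℕ) : Prop :=
  ∃ F : Fin m → C, (∀ i, HasLocalEnd (F i)) ∧ Nonempty (X ≅ ⨁ F)

/-- The least number of summands in a decomposition into objects with local endomorphism rings. -/
noncomputable def localLength (X : C) : ℕ := sInf {m | HasLocalDecomposition X m}

theorem IsKrullSchmidt.hasLocalDecomposition (h : IsKrullSchmidt C) (X : C) :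
    HasLocalDecomposition X (localLength X) := by
  obtain ⟨m, F, hF, e⟩ := h X
  exact Nat.sInf_mem (s := {m | HasLocalDecomposition X m}) ⟨m, F, fun i => hasLocalEnd_of_isLocalRing (hF i), e⟩

theorem HasLocalDecomposition.localLength_le {X : C} {m : ℕ} (h : HasLocalDecomposition X m) :
    localLength X ≤ m := Nat.sInf_le h

variable [HasBinaryBiproducts C]

/-- A finite biproduct is the biproduct of one of its terms and the sum of the others. -/
theorem exists_biproduct_iso_biprod {m : ℕ} (F : Fin (m + 1) → C) (j : Fin (m + 1)) :
    ∃ e : ⨁ F ≅ F j ⊞ ⨁ (fun i => F (j.succAbove i)),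
      e.hom ≫ biprod.fst = biproduct.π F j ∧ biprod.inl ≫ e.inv = biproduct.ι F j := by
  refine ⟨⟨biprod.lift (biproduct.π F j)
      (biproduct.lift fun i => biproduct.π F (j.succAbove i)),
    biprod.desc (biproduct.ι F j) (biproduct.desc fun i => biproduct.ι F (j.succAbove i)),
    ?_, ?_⟩, by simp, by simp⟩
  · rw [biprod.lift_desc, biproduct.lift_desc, ← biproduct.total,
      Fin.sum_univ_succAbove _ j]
  · apply biprod.hom_ext' <;> [skip; apply biproduct.hom_ext'] <;> [skip; intro i] <;>
      apply biprod.hom_ext <;> try apply biproduct.hom_ext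
    · simp
    · intro l
      simp [biproduct.ι_π_ne _ (Fin.succAbove_ne j l).symm]
    · simp [biproduct.ι_π_ne _ (Fin.succAbove_ne j i)]
    · intro l
      by_cases hil : i = l
      · subst hil
        simp
      · simp [biproduct.ι_π_ne _ hil,
          biproduct.ι_π_ne F (fun h => hil (Fin.succAbove_right_injective h))]

theorem HasLocalDecomposition.exists_splitting {m : ℕ} {X : C} (F : Fin m → C)
    (hF : ∀ i, HasLocalEnd (F i)) (e : X ≅ ⨁ F) (j : Fin m) :
    ∃ (R : C) (e' : X ≅ F j ⊞ R), localLength R < m ∧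
      e'.hom ≫ biprod.fst = e.hom ≫ biproduct.π F j ∧
      biprod.inl ≫ e'.inv = biproduct.ι F j ≫ e.inv := by
  cases m with
  | zero => exact j.elim0
  | succ m =>
    obtain ⟨e₀, h₁, h₂⟩ := exists_biproduct_iso_biprod F j
    refine ⟨_, e ≪≫ e₀, Nat.lt_succ_of_le (HasLocalDecomposition.localLength_le
      ⟨_, fun i => hF (j.succAbove i), ⟨Iso.refl _⟩⟩), ?_, ?_⟩
    · simp [h₁]
    · simp [reassoc_of% h₂]

/-- A morphism that is not radical has an isomorphism between indecomposable summands as a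
component. -/
theorem IsKrullSchmidt.exists_common_summand (h : IsKrullSchmidt C) {X Y : C} (f : X ⟶ Y)
    (hf : ¬ IsRadical f) :
    ∃ (F R R' : C) (e : X ≅ F ⊞ R) (e' : Y ≅ F ⊞ R'),
      localLength R < localLength X ∧ localLength R' < localLength Y ∧
      (biprod.inl ≫ e.inv) ≫ f ≫ e'.hom ≫ biprod.fst = 𝟙 F := by
  obtain ⟨F, hF, ⟨e⟩⟩ := h.hasLocalDecomposition X
  obtain ⟨G, hG, ⟨e'⟩⟩ := h.hasLocalDecomposition Y
  -- The radical is an ideal, so `f` would be radical if all its matrix entries were.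
  obtain ⟨i, j, hij⟩ : ∃ i j, ¬ IsRadical ((biproduct.ι F i ≫ e.inv) ≫ f ≫
      (e'.hom ≫ biproduct.π G j)) := by
    by_contra! hcon
    apply hf
    have hsum : f = ∑ i, ∑ j, (e.hom ≫ biproduct.π F i) ≫ ((biproduct.ι F i ≫ e.inv) ≫ f ≫
      (e'.hom ≫ biproduct.π G j)) ≫ biproduct.ι G j ≫ e'.inv := by
      have h₁ : f = e.hom ≫ (∑ i, biproduct.π F i ≫ biproduct.ι F i) ≫ e.inv ≫ f ≫ e'.hom ≫
          (∑ j, biproduct.π G j ≫ biproduct.ι G j) ≫ e'.inv := by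
        simp [biproduct.total]
      conv_lhs => rw [h₁]
      simp only [Preadditive.sum_comp, Preadditive.comp_sum, Category.assoc]
      rw [Finset.sum_comm]
    rw [hsum]
    exact isRadical_sum _ _ fun i _ => isRadical_sum _ _ fun j _ =>
      ((hcon i j).comp_right _).comp_left _
  have hiso := (hF i).isIso_of_not_isRadical (hG j) _ hij
  set w := (biproduct.ι F i ≫ e.inv) ≫ f ≫ (e'.hom ≫ biproduct.π G j) with hw
  obtain ⟨R, e₁, hR, -, h₂⟩ := HasLocalDecomposition.exists_splitting F hF e i
  obtain ⟨R', e₂, hR', h₃, -⟩ := HasLocalDecomposition.exists_splitting G hG e' j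
  -- The entry `w` is an isomorphism; twisting the splitting of `Y` by its inverse turns it into the
  -- identity.
  refine ⟨F i, R, R', e₁, e₂ ≪≫ biprod.mapIso (asIso w).symm (Iso.refl R'), hR, hR', ?_⟩
  simp only [Iso.trans_hom, Category.assoc, biprod.mapIso_hom, Iso.symm_hom, biprod.map_fst,
    asIso_inv]
  rw [reassoc_of% h₂, reassoc_of% h₃]
  have : ((biproduct.ι F i ≫ e.inv) ≫ f ≫ (e'.hom ≫ biproduct.π G j)) ≫ inv w = 𝟙 _ :=
    IsIso.hom_inv_id w
  simpa using this

theorem Indecomposable.hasLocalEnd (h : IsKrullSchmidt C) {X : C} (hX : Indecomposable X) :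
    HasLocalEnd X := by
  obtain ⟨m, F, hF, ⟨e⟩⟩ := h X
  replace hF := fun i => hasLocalEnd_of_isLocalRing (hF i)
  cases m with
  | zero =>
    refine absurd (IsZero.of_iso ?_ e) hX.1
    rw [IsZero.iff_id_eq_zero]
    exact biproduct.hom_ext _ _ fun j => j.elim0
  | succ m =>
    obtain ⟨R, e', -, -, -⟩ := HasLocalDecomposition.exists_splitting F hF e 0
    have hR := (hX.2 _ _ e').resolve_left (hF 0).1
    refine (hF 0).of_iso (Iso.symm (e' ≪≫ ⟨biprod.fst, biprod.inl, ?_, by simp⟩))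
    apply biprod.hom_ext' <;> simp
    exact hR.eq_of_src _ _

/-- Take a morphism right equivalent to `f` whose domain has least local length. If it were not
right minimal, it would vanish on a nontrivial split summand, and restricting it to a complement
would give a shorter domain. -/
theorem exists_isRightMinimalVersion (h : IsKrullSchmidt C) {X Y : C} (f : X ⟶ Y) :
    ∃ (X' : C) (f' : X' ⟶ Y), IsRightMinimalVersion f' f := by
  let P : ℕ → Prop := fun m => ∃ (X' : C) (f' : X' ⟶ Y), IsRightEquivalent f f' ∧
    localLength X' = m
  have hP : ∃ m, P m := ⟨_, X, f, ⟨⟨𝟙 _, by simp⟩, ⟨𝟙 _, by simp⟩⟩, rfl⟩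
  classical
  obtain ⟨X', f', hf', hm⟩ := Nat.find_spec hP
  refine ⟨X', f', ?_, hf'⟩
  intro e he
  by_contra hcon
  have hrad : ¬ IsRadical (𝟙 X' - e) := fun hr => hcon (by simpa using hr (𝟙 X'))
  obtain ⟨F, R, R', e₁, e₂, -, hR', hid⟩ := h.exists_common_summand _ hrad
  set z := (biprod.inl ≫ e₁.inv) ≫ (𝟙 X' - e) with hz
  have hzf : z ≫ f' = 0 := by simp [hz, he]
  have hz1 : z ≫ e₂.hom ≫ biprod.fst = 𝟙 F := by simpa [hz] using hid
  refine Nat.find_min hP (hm ▸ hR') ⟨R', (biprod.inr ≫ e₂.inv) ≫ f', ?_, rfl⟩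
  obtain ⟨⟨p, hp⟩, ⟨q, hq⟩⟩ := hf'
  -- `1 - π z`, with `π` the projection to `F`, lands in the complement `R'` because `z π = 1`, and
  -- it does not change `f'` because `z f' = 0`.
  refine ⟨⟨p ≫ (𝟙 X' - e₂.hom ≫ biprod.fst ≫ z) ≫ e₂.hom ≫ biprod.snd, ?_⟩,
    ⟨(biprod.inr ≫ e₂.inv) ≫ q, by simp [hq]⟩⟩
  have key : (𝟙 X' - e₂.hom ≫ biprod.fst ≫ z) ≫ (e₂.hom ≫ biprod.snd) ≫ (biprod.inr ≫ e₂.inv) =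
      𝟙 X' - e₂.hom ≫ biprod.fst ≫ z := by
    have h1 : (e₂.hom ≫ biprod.snd) ≫ (biprod.inr ≫ e₂.inv) =
        𝟙 X' - (e₂.hom ≫ biprod.fst) ≫ (biprod.inl ≫ e₂.inv) := by
      have := congrArg (fun x => e₂.hom ≫ x ≫ e₂.inv) (biprod.total (X := F) (Y := R'))
      simp only [Preadditive.add_comp, Preadditive.comp_add, Category.assoc, Category.id_comp,
        Iso.hom_inv_id] at this
      rw [← this]
      simp
    have h2 : (𝟙 X' - e₂.hom ≫ biprod.fst ≫ z) ≫ (e₂.hom ≫ biprod.fst) = 0 := by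
      simp [hz1]
    rw [h1, Preadditive.comp_sub,
      ← Category.assoc (𝟙 X' - e₂.hom ≫ biprod.fst ≫ z), h2]
    simp
  have := congrArg (fun x => p ≫ x ≫ f') key
  simp only [Category.assoc, Preadditive.sub_comp, Preadditive.comp_sub, Category.id_comp,
    hzf, comp_zero, sub_zero, hp] at this ⊢
  exact this

end KrullSchmidt

/-! ### Making the inner differentials radical -/

section Reduction

variable {C : Type u} [Category.{v} C] [Preadditive C] {n : ℕ} {A B : C}

/-- A homotopy-trivial idempotent chain map which splits in each degree and is the identity in the
end degrees replaces a complex by a homotopy equivalent one. -/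
theorem NComplex.exists_homotopyEquivalent_of_splitting (Z : NComplex n A B) (p : Z.K ⟶ Z.K)
    (H : Homotopy p (𝟙 Z.K)) (h₀ : p.f 0 = 𝟙 _) (h₁ : p.f (n + 1) = 𝟙 _) (L : ℕ → C)
    (q : ∀ i, Z.K.X i ⟶ L i) (σ : ∀ i, L i ⟶ Z.K.X i) (hσq : ∀ i, σ i ≫ q i = 𝟙 _)
    (hqσ : ∀ i, q i ≫ σ i = p.f i) :
    ∃ Z' : NComplex n A B, NComplex.HomotopyEquivalent Z Z' ∧ ∀ i, Z'.K.X i = L i := by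
  have hpq : ∀ i, p.f i ≫ q i = q i := fun i => by rw [← hqσ, Category.assoc, hσq, Category.comp_id]
  have hσp : ∀ i, σ i ≫ p.f i = σ i := fun i => by
    rw [← hqσ, ← Category.assoc, hσq, Category.id_comp]
  let K' : CochainComplex C ℕ :=
    { X := L
      d := fun i j => σ i ≫ Z.K.d i j ≫ q j
      shape := fun i j hij => by simp [Z.K.shape i j hij]
      d_comp_d' := fun i j l _ _ => by
        have : (σ i ≫ Z.K.d i j ≫ q j) ≫ σ j ≫ Z.K.d j l ≫ q l =
            σ i ≫ Z.K.d i j ≫ (q j ≫ σ j) ≫ Z.K.d j l ≫ q l := by simp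
        rw [this, hqσ]
        simp }
  let φ : Z.K ⟶ K' :=
    { f := q
      comm' := fun i j _ => by
        change q i ≫ σ i ≫ Z.K.d i j ≫ q j = _
        rw [← Category.assoc, hqσ, ← Category.assoc, p.comm, Category.assoc, hpq] }
  let ψ : K' ⟶ Z.K :=
    { f := σ
      comm' := fun i j _ => by
        change σ i ≫ Z.K.d i j = (σ i ≫ Z.K.d i j ≫ q j) ≫ σ j
        simp only [Category.assoc]
        rw [hqσ, ← p.comm, ← Category.assoc, hσp] }
  have hφψ : φ ≫ ψ = p := by ext i; exact hqσ i
  have hψφ : ψ ≫ φ = 𝟙 K' := by ext i; exact hσq i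
  let Z' : NComplex n A B :=
    { K := K'
      isZero := fun i hi => by
        rw [IsZero.iff_id_eq_zero]
        change 𝟙 (L i) = 0
        rw [← hσq, (Z.isZero i hi).eq_of_tgt (σ i) 0, zero_comp]
      left := ⟨σ 0 ≫ Z.left.hom, Z.left.inv ≫ q 0,
        by simpa using hσq 0, by simp [reassoc_of% (hqσ 0), h₀]⟩
      right := ⟨σ (n + 1) ≫ Z.right.hom, Z.right.inv ≫ q (n + 1),
        by simpa using hσq (n + 1), by simp [reassoc_of% (hqσ (n + 1)), h₁]⟩ }
  refine ⟨Z', ⟨⟨φ, ψ, (Homotopy.ofEq hφψ).trans H, Homotopy.ofEq hψφ⟩, ⟨?_, ?_⟩, ⟨?_, ?_⟩⟩,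
    fun i => rfl⟩
  · change q 0 ≫ σ 0 ≫ Z.left.hom = _
    simp [reassoc_of% (hqσ 0), h₀]
  · change q (n + 1) ≫ σ (n + 1) ≫ Z.right.hom = _
    simp [reassoc_of% (hqσ (n + 1)), h₁]
  · change σ 0 ≫ Z.left.hom = (σ 0 ≫ Z.left.hom) ≫ 𝟙 A
    simp
  · change σ (n + 1) ≫ Z.right.hom = (σ (n + 1) ≫ Z.right.hom) ≫ 𝟙 B
    simp

/-- `p` is `1 - (dh + hd)` for the homotopy `h` whose only nonzero component is `θ`. -/
theorem exists_homotopy_of_map (K : CochainComplex C ℕ) (m : ℕ) (θ : K.X (m + 1) ⟶ K.X m) :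
    ∃ (p : K ⟶ K) (_ : Homotopy p (𝟙 K)), p.f m = 𝟙 _ - K.d m (m + 1) ≫ θ ∧
      p.f (m + 1) = 𝟙 _ - θ ≫ K.d m (m + 1) ∧ ∀ i, i ≠ m → i ≠ m + 1 → p.f i = 𝟙 _ := by
  obtain ⟨hom, h₁, h₂⟩ : ∃ hom : ∀ i j, K.X i ⟶ K.X j, hom (m + 1) m = θ ∧
      ∀ i j, ¬ (i = m + 1 ∧ j = m) → hom i j = 0 := by
    refine ⟨fun i j => if h : i = m + 1 ∧ j = m then
      eqToHom (by rw [h.1]) ≫ θ ≫ eqToHom (by rw [h.2]) else 0, by simp, fun i j h => by simp [h]⟩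
  have hz : ∀ i j, ¬ (ComplexShape.up ℕ).Rel j i → hom i j = 0 := fun i j hij =>
    h₂ i j fun h => hij (by simp [h.1, h.2])
  have hf : ∀ i, (Homotopy.nullHomotopicMap hom : K ⟶ K).f i =
      K.d i (i + 1) ≫ hom (i + 1) i + prevD i hom := fun i => by
    rw [← dNext_eq hom (show (ComplexShape.up ℕ).Rel i (i + 1) from rfl)]
    rfl
  have hprev : ∀ i, i ≠ m + 1 → prevD i hom = 0 := fun i hi => by
    rw [prevD_nat, h₂ i _ (fun h => hi h.1), zero_comp]
  refine ⟨𝟙 K - Homotopy.nullHomotopicMap hom,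
    (Homotopy.equivSubZero.symm ((Homotopy.ofEq (sub_sub_cancel _ _)).trans
      (Homotopy.nullHomotopy hom hz))).symm, ?_, ?_, ?_⟩
  · simp [hf, h₁, hprev m (by omega)]
  · rw [HomologicalComplex.sub_f_apply, hf, h₂ (m + 1 + 1) (m + 1) (by omega),
      prevD_eq hom (show (ComplexShape.up ℕ).Rel m (m + 1) from rfl), h₁]
    simp
  · intro i hi hi'
    simp [hf, hprev i hi', h₂ (i + 1) i (by omega)]

/-- A complex with a non-radical inner differential is homotopy equivalent to a smaller one. -/
theorem NComplex.exists_smaller [HasFiniteBiproducts C] [HasBinaryBiproducts C]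
    (hKS : IsKrullSchmidt C) (Z : NComplex n A B) (m : ℕ) (hm : 1 ≤ m) (hmn : m + 1 ≤ n)
    (hd : ¬ IsRadical (Z.K.d m (m + 1))) :
    ∃ Z' : NComplex n A B, NComplex.HomotopyEquivalent Z Z' ∧
      ∑ i ∈ Finset.range (n + 2), localLength (Z'.K.X i) <
        ∑ i ∈ Finset.range (n + 2), localLength (Z.K.X i) := by
  obtain ⟨F, R, R', e, e', hR, hR', hid⟩ := hKS.exists_common_summand _ hd
  -- This `θ` inverts the differential on the common summand `F`, so `θ d θ = θ` and `p` is an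
  -- idempotent that removes `F` from degrees `m` and `m + 1`.
  obtain ⟨p, H, h₁, h₂, h₃⟩ := exists_homotopy_of_map Z.K m
    ((e'.hom ≫ biprod.fst) ≫ biprod.inl ≫ e.inv)
  have hid' : biprod.inl ≫ e.inv ≫ Z.K.d m (m + 1) ≫ e'.hom ≫ biprod.fst = 𝟙 F := by
    simpa using hid
  have tot : e.hom ≫ biprod.snd ≫ biprod.inr ≫ e.inv =
      𝟙 _ - e.hom ≫ biprod.fst ≫ biprod.inl ≫ e.inv := by
    have := congrArg (fun x => e.hom ≫ x ≫ e.inv) (biprod.total (X := F) (Y := R))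
    simp only [Preadditive.add_comp, Preadditive.comp_add, Category.assoc, Category.id_comp,
      Iso.hom_inv_id] at this
    rw [← this]
    abel
  have tot' : e'.hom ≫ biprod.snd ≫ biprod.inr ≫ e'.inv =
      𝟙 _ - e'.hom ≫ biprod.fst ≫ biprod.inl ≫ e'.inv := by
    have := congrArg (fun x => e'.hom ≫ x ≫ e'.inv) (biprod.total (X := F) (Y := R'))
    simp only [Preadditive.add_comp, Preadditive.comp_add, Category.assoc, Category.id_comp,
      Iso.hom_inv_id] at this
    rw [← this]
    abel
  have hex : ∀ i, ∃ (L : C) (q : Z.K.X i ⟶ L) (σ : L ⟶ Z.K.X i), σ ≫ q = 𝟙 _ ∧ q ≫ σ = p.f i ∧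
      localLength L ≤ localLength (Z.K.X i) ∧ (i = m → localLength L < localLength (Z.K.X i)) := by
    intro i
    by_cases hi : i = m
    · subst hi
      -- `p` kills the inclusion of `F`, hence factors through the projection to `R`; the inclusion
      -- of `R` has to be corrected by `p`.
      refine ⟨R, e.hom ≫ biprod.snd, biprod.inr ≫ e.inv ≫ p.f i, ?_, ?_, hR.le, fun _ => hR⟩
      · rw [h₁]
        simp
      · rw [Category.assoc, reassoc_of% tot, h₁]
        simp [reassoc_of% hid']
    · by_cases hi' : i = m + 1
      · subst hi'
        -- Dually, `p` followed by the projection to `F` is zero, so here the projection to `R'` is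
        -- the one corrected.
        refine ⟨R', p.f (m + 1) ≫ e'.hom ≫ biprod.snd, biprod.inr ≫ e'.inv, ?_, ?_, hR'.le,
          fun h => absurd h hi⟩
        · rw [h₂]
          simp
        · rw [Category.assoc, Category.assoc, tot', h₂]
          simp [reassoc_of% hid']
      · exact ⟨_, 𝟙 _, 𝟙 _, by simp, by simp [h₃ i hi hi'], le_rfl, fun h => absurd h hi⟩
  choose L q σ hσq hqσ hle hlt using hex
  obtain ⟨Z', hZ', hL⟩ := Z.exists_homotopyEquivalent_of_splitting p H (h₃ 0 (by omega) (by omega))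
    (h₃ (n + 1) (by omega) (by omega)) L q σ hσq hqσ
  refine ⟨Z', hZ', Finset.sum_lt_sum (fun i _ => (hL i).symm ▸ hle i)
    ⟨m, Finset.mem_range.2 (by omega), (hL m).symm ▸ hlt m rfl⟩⟩

/-- Every complex is homotopy equivalent to one with radical inner differentials. -/
theorem NComplex.exists_radical [HasFiniteBiproducts C] [HasBinaryBiproducts C]
    (hKS : IsKrullSchmidt C) (Z : NComplex n A B) :
    ∃ Z' : NComplex n A B, NComplex.HomotopyEquivalent Z Z' ∧
      ∀ i, 1 ≤ i → i + 1 ≤ n → IsRadical (Z'.K.d i (i + 1)) := by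
  induction hN : ∑ i ∈ Finset.range (n + 2), localLength (Z.K.X i) using Nat.strong_induction_on
    generalizing Z with
  | _ N ih =>
    by_cases hrad : ∀ i, 1 ≤ i → i + 1 ≤ n → IsRadical (Z.K.d i (i + 1))
    · exact ⟨Z, NComplex.homotopyEquivalent_equivalence.refl Z, hrad⟩
    · push Not at hrad
      obtain ⟨i, hi, hin, hd⟩ := hrad
      obtain ⟨Z₁, h₁, hlt⟩ := Z.exists_smaller hKS i hi hin hd
      obtain ⟨Z₂, h₂, hr⟩ := ih _ (hN ▸ hlt) Z₁ rfl
      exact ⟨Z₂, NComplex.homotopyEquivalent_equivalence.trans h₁ h₂, hr⟩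

end Reduction

/-! ### Functoriality of extensions and existence of weak kernels -/

section Extensions

variable {k : Type t} [CommRing k] {C : Type u} [Category.{v} C] {E : Cᵒᵖ ⥤ C ⥤ ModuleCat.{w} k}

@[simp]
theorem push_id {A B : C} (δ : Extension E B A) : push E (𝟙 A) δ = δ := by
  simp [push]

@[simp]
theorem push_comp {A A' A'' B : C} (a : A ⟶ A') (a' : A' ⟶ A'') (δ : Extension E B A) :
    push E (a ≫ a') δ = push E a' (push E a δ) := by
  simp [push]

@[simp]
theorem pull_id {A B : C} (δ : Extension E B A) : pull E (𝟙 B) δ = δ := by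
  simp [pull]

@[simp]
theorem pull_comp {A B B' B'' : C} (b : B'' ⟶ B') (b' : B' ⟶ B) (δ : Extension E B A) :
    pull E (b ≫ b') δ = pull E b (pull E b' δ) := by
  simp [pull]

theorem push_pull {A A' B B' : C} (a : A ⟶ A') (b : B' ⟶ B) (δ : Extension E B A) :
    push E a (pull E b δ) = pull E b (push E a δ) := by
  have := congrArg (fun φ => φ.hom δ) ((E.map b.op).naturality a)
  exact this.symm

@[simp]
theorem push_zero_right {A A' B : C} (a : A ⟶ A') : push E a (0 : Extension E B A) = 0 :=
  map_zero _

@[simp]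
theorem pull_zero_right {A B B' : C} (b : B' ⟶ B) : pull E b (0 : Extension E B A) = 0 :=
  map_zero _

@[simp]
theorem push_add_right {A A' B : C} (a : A ⟶ A') (δ δ' : Extension E B A) :
    push E a (δ + δ') = push E a δ + push E a δ' :=
  map_add _ _ _

variable [Preadditive C]

section Bilinear

variable [Linear k C]

theorem IsBilinear.push_zero (hE : IsBilinear E) {A A' B : C} (δ : Extension E B A) : push E (0 : A ⟶ A') δ = 0 := by
  simpa using hE.push_add (0 : A ⟶ A') 0 δ

theorem IsBilinear.push_sub (hE : IsBilinear E) {A A' B : C} (a a' : A ⟶ A') (δ : Extension E B A) :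
    push E (a - a') δ = push E a δ - push E a' δ := by
  have := hE.push_add (a - a') a' δ
  rw [sub_add_cancel] at this
  rw [this, add_sub_cancel_right]

theorem IsBilinear.push_sum (hE : IsBilinear E) {ι : Type*} (t : Finset ι) {A A' B : C} (a : ι → (A ⟶ A'))
    (δ : Extension E B A) : push E (∑ i ∈ t, a i) δ = ∑ i ∈ t, push E (a i) δ := by
  classical
  induction t using Finset.induction_on with
  | empty => simpa using hE.push_zero δ
  | insert i t hi ih => rw [Finset.sum_insert hi, Finset.sum_insert hi, hE.push_add, ih]

/-- An endomorphism of an object with local endomorphism ring that fixes a nonzero extension is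
invertible. -/
theorem HasLocalEnd.isIso_of_push_eq_self (hE : IsBilinear E) {A B : C} (hA : HasLocalEnd A) {δ : Extension E B A}
    (hδ : δ ≠ 0) (e : A ⟶ A) (he : push E e δ = δ) : IsIso e := by
  refine (hA.2 e).resolve_right fun h => hδ ?_
  have h₀ : push E (𝟙 A - e) δ = 0 := by rw [hE.push_sub, push_id, he, sub_self]
  have := congrArg (push E (inv (𝟙 A - e))) h₀
  rwa [← push_comp, IsIso.hom_inv_id, push_id, push_zero_right] at this

end Bilinear

variable {n : ℕ} {s : Correspondence E n}

theorem exists_realizes {A B : C} (δ : Extension E B A) :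
    ∃ X : NComplex n A B, Realizes s X δ := by
  obtain ⟨X, hX⟩ := Quotient.exists_rep (s A B δ)
  exact ⟨X, hX.symm⟩

theorem Realizes.of_homotopyEquivalent {A B : C} {X Y : NComplex n A B} {δ : Extension E B A}
    (hX : Realizes s X δ) (h : NComplex.HomotopyEquivalent X Y) : Realizes s Y δ :=
  Eq.trans hX (Quotient.sound h)

theorem Realizes.not_isSplitEpi_last (hs : IsExactRealization s) {A B : C} {X : NComplex n A B}
    {ρ : Extension E B A} (hX : Realizes s X ρ) (hρ : ρ ≠ 0) : ¬ IsSplitEpi X.last := by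
  intro h
  apply hρ
  rw [← pull_id ρ, ← IsSplitEpi.id X.last, pull_comp, (hs.isNExangle _ X hX).pull_last,
    pull_zero_right]

theorem Realizes.not_isSplitMono_first (hs : IsExactRealization s) {A B : C} {X : NComplex n A B}
    {ρ : Extension E B A} (hX : Realizes s X ρ) (hρ : ρ ≠ 0) : ¬ IsSplitMono X.first := by
  intro h
  apply hρ
  rw [← push_id ρ, ← IsSplitMono.id X.first, push_comp, (hs.isNExangle _ X hX).push_first,
    push_zero_right]

/-- `a` factors as a morphism followed by its right minimal version, so the latter is again a
deflation. -/
theorem exists_isIntrinsicWeakKernel [HasFiniteBiproducts C] [HasBinaryBiproducts C]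
    (hKS : IsKrullSchmidt C) (hWIC : WeakIdempotentCondition s)
    {X Y : C} {a : X ⟶ Y} (ha : IsDeflation s a) :
    ∃ K : C, IsIntrinsicWeakKernel s a K := by
  obtain ⟨X', f', hmin, ⟨r, hr⟩, ⟨r', hr'⟩⟩ := exists_isRightMinimalVersion hKS a
  obtain ⟨K, δ, Z, e, hZ, he⟩ := hWIC.deflation r f' (hr.symm ▸ ha)
  have hlast : Z.last = e.inv ≫ f' := by rw [← he, Iso.inv_hom_id_assoc]
  refine ⟨K, ha, δ, Z, hZ, fun g hg => ?_, ⟨r ≫ e.hom, by rw [Category.assoc, he, hr]⟩,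
    ⟨e.inv ≫ r', by rw [Category.assoc, hr', hlast]⟩⟩
  have := hmin (e.hom ≫ g ≫ e.inv) (by
    rw [Category.assoc, Category.assoc, ← hlast, hg, he])
  have hg' : g = e.inv ≫ (e.hom ≫ g ≫ e.inv) ≫ e.hom := by simp
  rw [hg']
  infer_instance

/-! ### Almost vanishing extensions -/

variable [Linear k C] [HasBinaryBiproducts C]

/-- Exactness at `𝔼(B, A)` of `C(A', A) → 𝔼(B, A) → 𝔼(X'ₙ, A)`. -/
theorem IsNExangulated.exists_push_eq (hs : IsNExangulated s) {A A' B : C} {X' : NComplex n A' B}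
    {ρ' : Extension E B A'} (hX' : Realizes s X' ρ') (ρ : Extension E B A)
    (h : pull E X'.last ρ = 0) : ∃ v : A' ⟶ A, push E v ρ' = ρ := by
  have hE := hs.bilinear
  -- `ω` has components `ρ'` and `ρ`. The cocone of a lift of `(fst, 1)` realizes the pullback of
  -- `ω` along `X'.last`, which `snd` pushes to zero; hence `snd` extends along the first map of the
  -- cocone.
  set ω : Extension E B (A' ⊞ A) := push E biprod.inl ρ' + push E biprod.inr ρ with hω
  have h_fst : push E biprod.fst ω = ρ' := by
    rw [hω, push_add_right, ← push_comp, ← push_comp, biprod.inl_fst, biprod.inr_fst, push_id,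
      hE.push_zero, add_zero]
  have h_snd : push E biprod.snd ω = ρ := by
    rw [hω, push_add_right, ← push_comp, ← push_comp, biprod.inl_snd, biprod.inr_snd, push_id,
      hE.push_zero, zero_add]
  obtain ⟨X, hX⟩ := exists_realizes (s := s) ω
  obtain ⟨f, hf, N, ⟨M⟩, hN⟩ := hs.good_lift_op biprod.fst ω X X' hX (h_fst.symm ▸ hX')
  have hz : push E biprod.snd (pull E X'.last ω) = 0 := by rw [push_pull, h_snd, h]
  obtain ⟨g, hg⟩ := ((hs.exact.isNExangle _ N hN).exact_from_ext A _).1 hz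
  have h₁ := M.first_eq hs.pos
  have h₂ : X.left.inv ≫ f.f 0 = biprod.fst ≫ X'.left.inv := by
    rw [Iso.inv_comp_eq, ← Category.assoc, ← hf.1]
    simp
  rw [← Iso.eq_comp_inv] at h₁
  -- The first map of the cocone has components `fst` and `X.first`. Pushing `ω` along this identity
  -- gives `ρ = v_* ρ'`, as `X.first` kills `ω`.
  have h₃ : (biprod.snd : A' ⊞ A ⟶ A) = biprod.fst ≫ (X'.left.inv ≫ biprod.inl ≫
      (M.iso 0 1 rfl hs.pos).inv ≫ g) + X.first ≫ biprod.inr ≫ (M.iso 0 1 rfl hs.pos).inv ≫ g := by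
    rw [← hg, h₁, h₂, biprod.lift_eq]
    simp
  have h₄ := h_snd
  rw [h₃, hE.push_add, push_comp biprod.fst, h_fst, push_comp X.first,
    (hs.exact.isNExangle _ X hX).push_first, push_zero_right, add_zero] at h₄
  exact ⟨_, h₄⟩

/-- `ρ` is nonzero but its pullback along every radical morphism vanishes. -/
def IsAlmostVanishing {A B : C} (ρ : Extension E B A) : Prop :=
  ρ ≠ 0 ∧ ∀ (W : C) (g : W ⟶ B), IsRadical g → pull E g ρ = 0

/-- An almost vanishing extension is a pushforward of every nonzero extension of the same object. -/
theorem IsAlmostVanishing.exists_push_eq (hs : IsNExangulated s) {A A' B : C}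
    (hB : HasLocalEnd B) {ρ : Extension E B A} (hρ : IsAlmostVanishing ρ) {ρ' : Extension E B A'}
    (hρ' : ρ' ≠ 0) : ∃ v : A' ⟶ A, push E v ρ' = ρ := by
  obtain ⟨X', hX'⟩ := exists_realizes (s := s) ρ'
  exact hs.exists_push_eq hX' ρ
    (hρ.2 _ _ (hB.isRadical_of_not_isSplitEpi _ (hX'.not_isSplitEpi_last hs.exact hρ')))

theorem IsAlmostVanishing.isAuslanderReiten (hs : IsNExangulated s) {A B : C}
    (hA : HasLocalEnd A) (hB : HasLocalEnd B) {ρ : Extension E B A} (hρ : IsAlmostVanishing ρ)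
    {X : NComplex n A B} (hX : Realizes s X ρ)
    (hrad : ∀ i, 1 ≤ i → i + 1 ≤ n → IsRadical (X.K.d i (i + 1))) : IsAuslanderReiten s X ρ where
  realizes := hX
  left_almost_split := by
    refine ⟨hX.not_isSplitMono_first hs.exact hρ.1, fun W u hu => ?_⟩
    refine ((hs.exact.isNExangle _ X hX).exact_from_ext W u).1 ?_
    -- If `u_* ρ ≠ 0`, some `v` pushes it back to `ρ`; then `u ≫ v` fixes `ρ`, so it is invertible
    -- and `u` splits.
    by_contra hne
    obtain ⟨v, hv⟩ := hρ.exists_push_eq hs hB hne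
    have := hA.isIso_of_push_eq_self hs.bilinear hρ.1 (u ≫ v) (by rw [push_comp, hv])
    exact hu (IsSplitMono.mk' ⟨v ≫ inv (u ≫ v), by rw [← Category.assoc, IsIso.hom_inv_id]⟩)
  right_almost_split := by
    refine ⟨hX.not_isSplitEpi_last hs.exact hρ.1, fun W g hg => ?_⟩
    exact ((hs.exact.isNExangle _ X hX).exact_to_ext W g).1
      (hρ.2 _ _ (hB.isRadical_of_not_isSplitEpi _ hg))
  radical := hrad

/-- Objects with local endomorphism rings carrying almost vanishing extensions of the same object
are isomorphic. -/
theorem IsAlmostVanishing.nonempty_iso (hs : IsNExangulated s) {A A' B : C}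
    (hA : HasLocalEnd A) (hA' : HasLocalEnd A') (hB : HasLocalEnd B) {ρ : Extension E B A}
    (hρ : IsAlmostVanishing ρ) {ρ' : Extension E B A'} (hρ' : IsAlmostVanishing ρ') :
    Nonempty (A ≅ A') := by
  obtain ⟨v, hv⟩ := hρ.exists_push_eq hs hB hρ'.1
  obtain ⟨v', hv'⟩ := hρ'.exists_push_eq hs hB hρ.1
  have := hA.isIso_of_push_eq_self hs.bilinear hρ.1 (v' ≫ v) (by rw [push_comp, hv', hv])
  have := hA'.isIso_of_push_eq_self hs.bilinear hρ'.1 (v ≫ v') (by rw [push_comp, hv, hv'])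
  have : IsSplitMono v' :=
    IsSplitMono.mk' ⟨v ≫ inv (v' ≫ v), by rw [← Category.assoc, IsIso.hom_inv_id]⟩
  have : IsSplitEpi v' := IsSplitEpi.mk' ⟨inv (v ≫ v') ≫ v, by simp⟩
  have : IsIso v' := isIso_of_mono_of_isSplitEpi v'
  exact ⟨asIso v'⟩

/-- An intrinsic weak kernel of a deflation through which some `h : T ⟶ Y` almost factors has an
indecomposable summand with an almost vanishing extension of `T`. -/
theorem IsIntrinsicWeakKernel.exists_summand [HasFiniteBiproducts C] (hs : IsNExangulated s)
    (hKS : IsKrullSchmidt C) {X Y T K : C} {a : X ⟶ Y} (hK : IsIntrinsicWeakKernel s a K)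
    {h : T ⟶ Y} (hh : AlmostFactorsThrough h a) :
    ∃ (A : C) (ρ : Extension E T A), HasLocalEnd A ∧ IsAlmostVanishing ρ ∧
      IsDirectSummand A K := by
  obtain ⟨-, δ, Z, hZ, -, ⟨b, hb⟩, ⟨b', hb'⟩⟩ := hK
  have hex := (hs.exact.isNExangle _ Z hZ).exact_to_ext
  have hne : pull E h δ ≠ 0 := fun h₀ => by
    obtain ⟨g, hg⟩ := (hex T h).1 h₀
    exact hh.1 ⟨g ≫ b', by rw [Category.assoc, hb', ← hg]⟩
  have hvan : ∀ (W : C) (g : W ⟶ T), IsRadical g → pull E g (pull E h δ) = 0 := by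
    intro W g hg
    obtain ⟨r, hr⟩ := hh.2 W g hg
    rw [← pull_comp]
    exact (hex W (g ≫ h)).2 ⟨r ≫ b, by simp only [Category.assoc, hb, hr]⟩
  obtain ⟨m, F, hF, ⟨e⟩⟩ := hKS K
  replace hF := fun i => hasLocalEnd_of_isLocalRing (hF i)
  obtain ⟨i, hi⟩ : ∃ i, push E (e.hom ≫ biproduct.π F i) (pull E h δ) ≠ 0 := by
    by_contra! hcon
    apply hne
    have hid : 𝟙 K = ∑ i, (e.hom ≫ biproduct.π F i) ≫ biproduct.ι F i ≫ e.inv := by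
      have : 𝟙 K = e.hom ≫ (∑ i, biproduct.π F i ≫ biproduct.ι F i) ≫ e.inv := by
        simp [biproduct.total]
      rw [this]
      simp only [Preadditive.sum_comp, Preadditive.comp_sum, Category.assoc]
    rw [← push_id (pull E h δ), hid, hs.bilinear.push_sum]
    refine Finset.sum_eq_zero fun i _ => ?_
    rw [push_comp, hcon i, push_zero_right]
  obtain ⟨R, e', -⟩ := HasLocalDecomposition.exists_splitting F hF e i
  refine ⟨F i, _, hF i, ⟨hi, fun W g hg => ?_⟩, R, ⟨e'⟩⟩
  rw [← push_pull, hvan W g hg, push_zero_right]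

end Extensions

end NExangulated

theorem lemma4p12 {k : Type t} [CommRing k] [IsArtinianRing k]
    {C : Type u} [Category.{v} C] [Preadditive C] [Linear k C]
    [HasFiniteBiproducts C] [HasBinaryBiproducts C]
    {n : ℕ} {E : Cᵒᵖ ⥤ C ⥤ ModuleCat.{w} k} (s : NExangulated.Correspondence E n)
    (hs : NExangulated.IsNExangulated s)
    (hfin : NExangulated.IsExtFinite E)
    (hKS : NExangulated.IsKrullSchmidt C)
    (hWIC : NExangulated.WeakIdempotentCondition s)
    {X Y : C} (a : X ⟶ Y) (ha : NExangulated.IsDeflation s a)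
    (T : C) (hT : Indecomposable T)
    (h : T ⟶ Y) (hh : NExangulated.AlmostFactorsThrough h a) :
    ∃ (Z₀ : C) (ρ : NExangulated.Extension E T Z₀) (Z : NExangulated.NComplex n Z₀ T),
      NExangulated.IsAuslanderReiten s Z ρ ∧
      (∃ K : C, NExangulated.IsIntrinsicWeakKernel s a K) ∧
      ∀ K : C, NExangulated.IsIntrinsicWeakKernel s a K → NExangulated.IsDirectSummand Z₀ K := by
  have hTloc := NExangulated.Indecomposable.hasLocalEnd hKS hT
  obtain ⟨K, hK⟩ := NExangulated.exists_isIntrinsicWeakKernel hKS hWIC ha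
  obtain ⟨Z₀, ρ, hZ₀, hρ, -⟩ := hK.exists_summand hs hKS hh
  obtain ⟨Z, hZ⟩ := NExangulated.exists_realizes (s := s) ρ
  obtain ⟨Z', hZZ', hrad⟩ := Z.exists_radical hKS
  refine ⟨Z₀, ρ, Z', hρ.isAuslanderReiten hs hZ₀ hTloc (hZ.of_homotopyEquivalent hZZ') hrad,
    ⟨K, hK⟩, fun K' hK' => ?_⟩
  -- `K'` yields its own summand `A`, which is isomorphic to `Z₀` since both carry almost vanishing
  -- extensions of `T`.
  obtain ⟨A, ρ', hA, hρ', R, ⟨e⟩⟩ := hK'.exists_summand hs hKS hh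
  obtain ⟨i⟩ := hρ'.nonempty_iso hs hA hZ₀ hTloc hρ
  exact ⟨R, ⟨e ≪≫ biprod.mapIso i (Iso.refl R)⟩⟩
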